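/- Let $\mathbb T\subseteq\mathbb R$ be a time scale (a nonempty closed set), let $a<b$ be points of $\mathbb T$, put $I_{\mathbb T}=[a,\infty)\cap\mathbb T$, and let $\mathbb X$ be a Banach space. Write $\sigma(t)=\inf\{s\in\mathbb T:s>t\}$ (with $\sigma(\max\mathbb T)=\max\mathbb T$ if the maximum exists) and $\mu(t)=\sigma(t)-t$, and let $\int\cdots\Delta s$ denote the delta integral, $\int_r^s\varphi(\tau)\Delta\tau=\Phi(s)-\Phi(r)$ where $\Phi^\Delta=\varphi$. A function is rd-continuous if it is continuous at right-dense points and has left-sided limits at left-dense points. For rd-continuous $p$ with $1+\mu p>0$ let $e_p(t,s)=\exp\big(\int_s^t\xi_{\mu(\tau)}(p(\tau))\Delta\tau\big)$, where $\xi_h(z)=\log(1+hz)/h$ for $h\ne0$ and $\xi_0(z)=z$; further let $p\ominus r=\dfrac{p-r}{1+\mu r}$. Let $f:I_{\mathbb T}\times\mathbb X^3\to\mathbb X$ be rd-continuous in the first variable and let $h,g:I_{\mathbb T}^2\times\mathbb X\to\mathbb X$ be rd-continuous in the second variable. Consider the equation $$x(t)=f\Big(t,x(t),\int_a^t h(t,s,x(s))\Delta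 s,\int_a^b g(t,s,x(s))\Delta s\Big),\qquad t\in I_{\mathbb T},\tag{e1}$$ a solution of which is an rd-continuous function $x:I_{\mathbb T}\to\mathbb X$ satisfying (e1). Theorem 5.1. Suppose that there are constants $\alpha,B,C>0$, $0\le N<1$ and $d\ge0$ such that, for all $t,s\in I_{\mathbb T}$ and all $u,v,w,\bar u,\bar v,\bar w\in\mathbb X$, $$\|f(t,u,v,w)-f(t,\bar u,\bar v,\bar w)\|\le N\big(\|u-\bar u\|+\|v-\bar v\|+\|w-\bar w\|\big),$$ $$\|h(t,s,v)-h(t,s,\bar v)\|\le B\,e_\alpha(s,t)\,\|v-\bar v\|,\qquad \|g(t,s,u)-g(t,s,\bar u)\|\le C\,e_\alpha(s,t)\,\|u-\bar u\|,$$ $$q:=\int_a^b C N^*e_{BN^*}(s,a)\,\Delta s<1,\qquad N^*=\frac{N}{1-N},$$ $$\Big\|f\Big(t,0,\int_a^t h(t,s,0)\Delta s,\int_a^b g(t,s,0)\Delta s\Big)\Big\|\le\frac{d}{e_\alpha(t,a)}.$$ Then every solution $x$ of (e1) satisfies $$\|x(t)\|\le\frac{d}{(1-N)(1-q)}\,e_{BN^*\ominus\alpha}(t,a),\qquad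 t\in I_{\mathbb T}.$$ -/

import Mathlib

open Set Filter Topology

noncomputable section

namespace TimeScale

/-- A time scale: a nonempty closed set of real numbers. -/
def IsTimeScale (T : Set ℝ) : Prop := T.Nonempty ∧ IsClosed T

/-- The part `[a, ∞) ∩ T` of the set `T`.  For a time scale `T` and `a ∈ T` it is again a time
scale, with the same forward jump operator as `T`. -/
def ray (T : Set ℝ) (a : ℝ) : Set ℝ := T ∩ Ici a

open Classical in
/-- The forward jump operator `σ(t) = inf {s ∈ T : s > t}`; with the usual convention
`inf ∅ = sup T`, the maximum of `T` (if there is one) is sent to itself. -/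
def sigma (T : Set ℝ) (t : ℝ) : ℝ :=
  if {s | s ∈ T ∧ t < s}.Nonempty then sInf {s | s ∈ T ∧ t < s} else t

open Classical in
/-- The backward jump operator `ρ(t) = sup {s ∈ T : s < t}`; with the usual convention
`sup ∅ = inf T`, the minimum of `T` (if there is one) is sent to itself. -/
def rho (T : Set ℝ) (t : ℝ) : ℝ :=
  if {s | s ∈ T ∧ s < t}.Nonempty then sSup {s | s ∈ T ∧ s < t} else t

/-- The graininess `μ(t) = σ(t) - t`. -/
def graininess (T : Set ℝ) (t : ℝ) : ℝ := sigma T t - t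

/-- `t` is right-dense: `t ∈ T`, `t < sup T` and `σ(t) = t`. -/
def RightDense (T : Set ℝ) (t : ℝ) : Prop := t ∈ T ∧ (∃ s ∈ T, t < s) ∧ sigma T t = t

/-- `t` is left-dense: `t ∈ T`, `t > inf T` and `ρ(t) = t`. -/
def LeftDense (T : Set ℝ) (t : ℝ) : Prop := t ∈ T ∧ (∃ s ∈ T, s < t) ∧ rho T t = t

variable {X : Type*} [NormedAddCommGroup X] [NormedSpace ℝ X]

/-- `f : T → X` is rd-continuous: it is continuous (on `T`) at every right-dense point and has a
left-sided limit (along `T`) at every left-dense point.  Only the values of `f` on `T` matter. -/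
def RdContinuous (T : Set ℝ) (f : ℝ → X) : Prop :=
  (∀ t, RightDense T t → ContinuousWithinAt f T t) ∧
  (∀ t, LeftDense T t → ∃ l : X, Tendsto f (𝓝[T ∩ Iio t] t) (𝓝 l))

/-- `F` has the delta derivative `F'` at the point `t` of `T`: for every `ε > 0` there is a
neighbourhood `U` of `t` in `T` such that
`‖(F (σ t) - F s) - (σ t - s) F'‖ ≤ ε |σ t - s|` for all `s ∈ U`. -/
def HasDeltaDerivAt (T : Set ℝ) (F : ℝ → X) (F' : X) (t : ℝ) : Prop :=
  ∀ ε : ℝ, 0 < ε → ∀ᶠ s in 𝓝[T] t,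
    ‖(F (sigma T t) - F s) - (sigma T t - s) • F'‖ ≤ ε * |sigma T t - s|

/-- `F` is an antiderivative of `f` on `T`: `F` is continuous on `T` and `F^Δ(t) = f(t)` for every
`t ∈ T` other than the maximum of `T` (if there is one).  Continuity at the points `t ≠ max T` is a
consequence of differentiability.  At a left-scattered maximum the requirement `F^Δ(t) = f(t)` would
be void.  At a left-dense maximum only continuity is asked for, because rd-continuity of `f`
does not make `f` continuous there; in this way every rd-continuous function has an
antiderivative. -/
def IsAntiderivative (T : Set ℝ) (F f : ℝ → X) : Prop :=
  ContinuousOn F T ∧ ∀ t ∈ T, (∃ s ∈ T, t < s) → HasDeltaDerivAt T F (f t) t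

open Classical in
/-- The delta integral `∫_r^s f(τ) Δτ = F(s) - F(r)` over the time scale `T`, where `F` is an
antiderivative of `f` (two of them differ by a constant on `T`; the value is `0` if there
is none, which does not happen for rd-continuous `f` with values in a Banach space). -/
def deltaIntegral (T : Set ℝ) (f : ℝ → X) (r s : ℝ) : X :=
  if hF : ∃ F : ℝ → X, IsAntiderivative T F f then hF.choose s - hF.choose r else 0

/-- The cylinder transformation `ξ_h(z)`, for `1 + h z > 0`. -/
def cylinder (h z : ℝ) : ℝ := if h = 0 then z else Real.log (1 + h * z) / h

/-- The generalized exponential function `e_p(t, s) = exp (∫_s^t ξ_{μ(τ)}(p(τ)) Δτ)`, for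
positively regressive `p` (that is, `p` rd-continuous with `1 + μ p > 0` on `T`). -/
def expT (T : Set ℝ) (p : ℝ → ℝ) (t s : ℝ) : ℝ :=
  Real.exp (deltaIntegral T (fun τ => cylinder (graininess T τ) (p τ)) s t)

/-- The circle sum `p ⊕ q = p + q + μ p q`. -/
def circlePlus (T : Set ℝ) (p q : ℝ → ℝ) : ℝ → ℝ :=
  fun t => p t + q t + graininess T t * p t * q t

/-- The circle negative `⊖ q = - q / (1 + μ q)`. -/
def circleNeg (T : Set ℝ) (q : ℝ → ℝ) : ℝ → ℝ :=
  fun t => -q t / (1 + graininess T t * q t)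

/-- The circle difference `p ⊖ q = p ⊕ (⊖ q)`. -/
def circleMinus (T : Set ℝ) (p q : ℝ → ℝ) : ℝ → ℝ := circlePlus T p (circleNeg T q)

/-- `x` is a solution on the time scale `I` (with `a, b ∈ I`) of the Volterra-Fredholm dynamic
integral equation `x(t) = f(t, x(t), ∫_a^t h(t,s,x(s)) Δs, ∫_a^b g(t,s,x(s)) Δs)`, `t ∈ I`:
an rd-continuous function on `I` satisfying this equation. -/
def IsSolution (I : Set ℝ) (a b : ℝ) (f : ℝ → X → X → X → X) (h g : ℝ → ℝ → X → X)
    (x : ℝ → X) : Prop :=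
  RdContinuous I x ∧ ∀ t ∈ I,
    x t = f t (x t) (deltaIntegral I (fun s => h t s (x s)) a t)
      (deltaIntegral I (fun s => g t s (x s)) a b)

end TimeScale

end

/-! The weight `u s = e_α(s,a) ‖x s‖` turns the nonlinear equation into a linear scalar inequality.
Comparing `x` with the forcing term and using `e_α(s,t) = e_α(s,a) / e_α(t,a)` to take `t` out of
both kernels gives `u ≤ N (u + B ∫_a^t u + C J) + d`, where `J = ∫_a^b u`. Absorbing `N u` on the
left produces `u ≤ K + B N* ∫_a^t u` with `K = d / (1 - N) + N* C J`. Gronwall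
(`le_mul_expT_of_le_deltaIntegral`) yields `u ≤ K e_{BN*}(·,a)`. Integrating this over `[a,b]`
bounds `J`, hence `K ≤ d / (1 - N) + K q`, and `q < 1` bounds `K`. Dividing by `e_α(t,a)` finishes.

The calculus on the time scale is transferred to the real line: composing with `floorIn` freezes a
function across each gap, an rd-continuous function becomes right-continuous with left limits, and
its delta integral becomes an ordinary interval integral (`deltaIntegral_eq_integral_floorIn`).
Linearity, monotonicity and Gronwall then come from their classical versions. -/

namespace TimeScale

open MeasureTheory

/-! ### Projection of the real line onto the time scale -/

section Floor

/-- The last point of `T` that is at most `r`, or `a` when `r < a`; here `a` is the least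
element of the closed set `T`. -/
noncomputable def floorIn (T : Set ℝ) (a r : ℝ) : ℝ := sSup (T ∩ Iic (max a r))

variable {T : Set ℝ} {a : ℝ}

theorem isGreatest_floorIn (hT : IsClosed T) (ha : IsLeast T a) (r : ℝ) :
    IsGreatest (T ∩ Iic (max a r)) (floorIn T a r) := by
  have hb : BddAbove (T ∩ Iic (max a r)) := ⟨max a r, fun s hs => hs.2⟩
  exact ⟨(hT.inter isClosed_Iic).csSup_mem ⟨a, ha.1, mem_Iic.2 (le_max_left _ _)⟩ hb,
    fun s hs => le_csSup hb hs⟩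

theorem floorIn_mem (hT : IsClosed T) (ha : IsLeast T a) (r : ℝ) : floorIn T a r ∈ T :=
  (isGreatest_floorIn hT ha r).1.1

theorem floorIn_le (hT : IsClosed T) (ha : IsLeast T a) {r : ℝ} (hr : a ≤ r) :
    floorIn T a r ≤ r := by
  simpa [hr] using (isGreatest_floorIn hT ha r).1.2

theorem le_floorIn (hT : IsClosed T) (ha : IsLeast T a) {r s : ℝ} (hs : s ∈ T) (hsr : s ≤ r) :
    s ≤ floorIn T a r :=
  (isGreatest_floorIn hT ha r).2 ⟨hs, hsr.trans (le_max_right _ _)⟩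

theorem floorIn_of_mem (hT : IsClosed T) (ha : IsLeast T a) {r : ℝ} (hr : r ∈ T) :
    floorIn T a r = r :=
  le_antisymm (floorIn_le hT ha (ha.2 hr)) (le_floorIn hT ha hr le_rfl)

theorem tendsto_floorIn_nhdsGE (hT : IsClosed T) (ha : IsLeast T a) {r : ℝ} (hr : r ∈ T) :
    Tendsto (floorIn T a) (𝓝[≥] r) (𝓝[T] r) := by
  refine tendsto_nhdsWithin_iff.2 ⟨?_, Eventually.of_forall fun s => floorIn_mem hT ha s⟩
  refine tendsto_of_tendsto_of_tendsto_of_le_of_le' tendsto_const_nhds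
    (tendsto_id.mono_left inf_le_left) ?_ ?_
  · filter_upwards [self_mem_nhdsWithin] with s hs using le_floorIn hT ha hr hs
  · filter_upwards [self_mem_nhdsWithin] with s hs using floorIn_le hT ha ((ha.2 hr).trans hs)

theorem floorIn_eq_of_gap {r r' : ℝ} (hrr : r ≤ r') (hgap : ∀ s ∈ T, r < s → r' < s) :
    floorIn T a r' = floorIn T a r := by
  unfold floorIn
  congr 1
  ext s
  simp only [mem_inter_iff, mem_Iic, le_max_iff, and_congr_right_iff]
  intro hs
  constructor
  · rintro (h | h)
    · exact Or.inl h
    · by_contra! hcon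
      exact absurd (hgap s hs hcon.2) (not_lt.2 h)
  · rintro (h | h)
    · exact Or.inl h
    · exact Or.inr (h.trans hrr)

end Floor

/-! ### Jump operators and dense points -/

section Jump

variable {T : Set ℝ}

theorem bddBelow_after (T : Set ℝ) (t : ℝ) : BddBelow {s | s ∈ T ∧ t < s} :=
  ⟨t, fun _ hs => hs.2.le⟩

theorem sigma_le {t s : ℝ} (hs : s ∈ T) (hts : t < s) : sigma T t ≤ s := by
  unfold sigma
  rw [if_pos ⟨s, hs, hts⟩]
  exact csInf_le (bddBelow_after T t) ⟨hs, hts⟩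

theorem le_sigma (T : Set ℝ) (t : ℝ) : t ≤ sigma T t := by
  unfold sigma
  split_ifs with h
  · exact le_csInf h fun _ hs => hs.2.le
  · exact le_rfl

theorem graininess_nonneg (T : Set ℝ) (t : ℝ) : 0 ≤ graininess T t :=
  sub_nonneg.2 (le_sigma T t)

theorem exists_mem_Ioo_of_sigma_eq {t r : ℝ} (hmax : ∃ s ∈ T, t < s) (h : sigma T t = t)
    (hr : t < r) : ∃ s ∈ T, t < s ∧ s < r := by
  obtain ⟨s, hs, hts⟩ := hmax
  have hne : {s | s ∈ T ∧ t < s}.Nonempty := ⟨s, hs, hts⟩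
  unfold sigma at h
  rw [if_pos hne] at h
  obtain ⟨s', hs', hlt⟩ := exists_lt_of_csInf_lt hne (h.trans_lt hr)
  exact ⟨s', hs'.1, hs'.2, hlt⟩

/-- Membership in `T` comes from closedness, so an arbitrary real point is either right-dense or
followed by a gap; later case splits rest on this dichotomy. -/
theorem rightDense_of_forall (hT : IsClosed T) {t : ℝ} (h : ∀ r, t < r → ∃ s ∈ T, t < s ∧ s < r) :
    RightDense T t := by
  have hmem : t ∈ T := by
    rw [← hT.closure_eq, Metric.mem_closure_iff]
    intro ε hε
    obtain ⟨s, hs, h1, h2⟩ := h (t + ε) (by linarith)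
    exact ⟨s, hs, by rw [Real.dist_eq, abs_lt]; constructor <;> linarith⟩
  refine ⟨hmem, ?_, le_antisymm (le_of_forall_gt_imp_ge_of_dense fun r hr => ?_) (le_sigma T t)⟩
  · obtain ⟨s, hs, h1, -⟩ := h (t + 1) (by linarith)
    exact ⟨s, hs, h1⟩
  · obtain ⟨s, hs, h1, h2⟩ := h r hr
    exact (sigma_le hs h1).trans h2.le

theorem leftDense_of_forall (hT : IsClosed T) {t : ℝ} (h : ∀ r, r < t → ∃ s ∈ T, r < s ∧ s < t) :
    LeftDense T t := by
  have hmem : t ∈ T := by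
    rw [← hT.closure_eq, Metric.mem_closure_iff]
    intro ε hε
    obtain ⟨s, hs, h1, h2⟩ := h (t - ε) (by linarith)
    exact ⟨s, hs, by rw [Real.dist_eq, abs_lt]; constructor <;> linarith⟩
  obtain ⟨s, hs, -, h1⟩ := h (t - 1) (by linarith)
  refine ⟨hmem, ⟨s, hs, h1⟩, ?_⟩
  have hne : {s | s ∈ T ∧ s < t}.Nonempty := ⟨s, hs, h1⟩
  unfold rho
  rw [if_pos hne]
  refine le_antisymm (csSup_le hne fun _ hs => hs.2.le) (le_of_forall_lt_imp_le_of_dense fun r hr => ?_)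
  obtain ⟨s', hs', h1', h2'⟩ := h r hr
  exact h1'.le.trans (le_csSup ⟨t, fun _ hs => hs.2.le⟩ ⟨hs', h2'⟩)

end Jump

/-! ### Delta derivatives at dense and scattered points -/

section DeltaDeriv

variable {X : Type*} [NormedAddCommGroup X] [NormedSpace ℝ X] {T : Set ℝ} {F G : ℝ → X}
  {F' G' : X} {t : ℝ}

theorem hasDeltaDerivAt_iff_of_sigma_eq (h : sigma T t = t) :
    HasDeltaDerivAt T F F' t ↔ HasDerivWithinAt F F' T t := by
  rw [hasDerivWithinAt_iff_isLittleO, Asymptotics.isLittleO_iff]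
  unfold HasDeltaDerivAt
  refine forall₂_congr fun ε _ => eventually_congr (Eventually.of_forall fun s => ?_)
  rw [h, ← norm_neg, Real.norm_eq_abs, abs_sub_comm]
  congr! 2
  module

/-- The defining estimate may be evaluated at `s = t` itself, for every `ε`; letting `ε → 0` makes
it an equality. -/
theorem HasDeltaDerivAt.sub_sigma (h : HasDeltaDerivAt T F F' t) (ht : t ∈ T) :
    F (sigma T t) = F t + graininess T t • F' := by
  have key : ∀ ε : ℝ, 0 < ε →
      ‖(F (sigma T t) - F t) - (sigma T t - t) • F'‖ ≤ ε * |sigma T t - t| :=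
    fun ε hε => (h ε hε).self_of_nhdsWithin ht
  have h0 : ‖(F (sigma T t) - F t) - (sigma T t - t) • F'‖ ≤ 0 := by
    have hlim : Tendsto (fun ε : ℝ => ε * |sigma T t - t|) (𝓝[>] 0) (𝓝 0) := by
      have hcont : Continuous fun ε : ℝ => ε * |sigma T t - t| := by fun_prop
      simpa using (hcont.tendsto 0).mono_left (nhdsWithin_le_nhds (s := Ioi 0))
    exact ge_of_tendsto hlim (by filter_upwards [self_mem_nhdsWithin] with ε hε using key ε hε)
  have h1 := norm_le_zero_iff.1 h0
  rw [sub_sub, sub_eq_zero] at h1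
  exact h1

theorem hasDeltaDerivAt_of_lt_sigma (h : t < sigma T t) (hc : ContinuousWithinAt F T t)
    (hF : F (sigma T t) = F t + graininess T t • F') : HasDeltaDerivAt T F F' t := by
  intro ε hε
  have h1 : ContinuousWithinAt
      (fun s => ‖(F (sigma T t) - F s) - (sigma T t - s) • F'‖ - ε * |sigma T t - s|) T t := by
    have hid : ContinuousWithinAt (fun s : ℝ => sigma T t - s) T t :=
      (continuous_const.sub continuous_id).continuousWithinAt
    exact (((continuousWithinAt_const.sub hc).sub (hid.smul continuousWithinAt_const)).norm).sub
      (continuousWithinAt_const.mul hid.abs)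
  have h2 : ‖(F (sigma T t) - F t) - (sigma T t - t) • F'‖ - ε * |sigma T t - t| < 0 := by
    rw [hF, graininess, add_sub_cancel_left, sub_self, norm_zero, zero_sub, neg_lt_zero]
    exact mul_pos hε (abs_pos.2 (sub_ne_zero.2 h.ne'))
  filter_upwards [h1.eventually_lt_const h2] with s hs
  linarith

theorem HasDeltaDerivAt.sub (hF : HasDeltaDerivAt T F F' t) (hG : HasDeltaDerivAt T G G' t) :
    HasDeltaDerivAt T (fun s => F s - G s) (F' - G') t := by
  intro ε hε
  filter_upwards [hF (ε / 2) (half_pos hε), hG (ε / 2) (half_pos hε)] with s h1 h2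
  calc _ = ‖((F (sigma T t) - F s) - (sigma T t - s) • F') -
        ((G (sigma T t) - G s) - (sigma T t - s) • G')‖ := by congr 1; module
    _ ≤ _ := (norm_sub_le _ _).trans (add_le_add h1 h2)
    _ = _ := by ring

end DeltaDeriv

/-! ### Right-continuous functions with left limits -/

section Cadlag

variable {X : Type*} [NormedAddCommGroup X]

/-- Sampling at the next point of the grid of mesh `1 / (n + 1)` gives functions that factor through
`ℤ`; the sample points approach `r` from the right, where `φ` is continuous. -/
theorem stronglyMeasurable_of_continuousWithinAt_Ici {φ : ℝ → X}
    (h : ∀ r, ContinuousWithinAt φ (Ici r) r) : StronglyMeasurable φ := by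
  refine stronglyMeasurable_of_tendsto (u := atTop)
    (f := fun (n : ℕ) (r : ℝ) => φ ((⌊r * (n + 1)⌋ + 1 : ℤ) / ((n : ℝ) + 1))) (fun n => ?_) ?_
  · have h1 : StronglyMeasurable fun k : ℤ => φ ((k + 1 : ℤ) / ((n : ℝ) + 1)) :=
      StronglyMeasurable.of_discrete
    exact h1.comp_measurable (Int.measurable_floor.comp (measurable_id.mul_const _))
  · rw [tendsto_pi_nhds]
    intro r
    refine (h r).tendsto.comp (tendsto_nhdsWithin_iff.2 ⟨?_, Eventually.of_forall fun n => ?_⟩)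
    · have hlim : Tendsto (fun n : ℕ => r + 1 / ((n : ℝ) + 1)) atTop (𝓝 r) := by
        simpa using tendsto_const_nhds.add (tendsto_one_div_add_atTop_nhds_zero_nat (𝕜 := ℝ))
      refine tendsto_of_tendsto_of_tendsto_of_le_of_le tendsto_const_nhds hlim
        (fun n => ?_) (fun n => ?_)
      · have hn : (0 : ℝ) < n + 1 := by positivity
        dsimp only
        rw [le_div_iff₀ hn]
        push_cast
        exact (Int.lt_floor_add_one _).le
      · have hn : (0 : ℝ) < n + 1 := by positivity
        dsimp only
        rw [div_le_iff₀ hn, add_mul, one_div, inv_mul_cancel₀ hn.ne']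
        push_cast
        linarith [Int.floor_le (r * ((n : ℝ) + 1))]
    · have hn : (0 : ℝ) < n + 1 := by positivity
      rw [mem_Ici, le_div_iff₀ hn]
      push_cast
      exact (Int.lt_floor_add_one _).le

theorem locallyIntegrable_of_cadlag {φ : ℝ → X} (hr : ∀ r, ContinuousWithinAt φ (Ici r) r)
    (hl : ∀ r, ∃ l, Tendsto φ (𝓝[<] r) (𝓝 l)) : LocallyIntegrable φ := by
  intro r
  have hm := (stronglyMeasurable_of_continuousWithinAt_Ici hr).aestronglyMeasurable (μ := volume)
  obtain ⟨l, hl⟩ := hl r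
  rw [← nhdsLT_sup_nhdsGE, IntegrableAtFilter.sup_iff]
  have hfin : volume.FiniteAtFilter (𝓝 r) := volume.finiteAt_nhds r
  exact ⟨(hfin.filter_mono inf_le_left).integrableAtFilter_of_tendsto
      (hm.stronglyMeasurableAtFilter) hl,
    (hfin.filter_mono inf_le_left).integrableAtFilter_of_tendsto
      (hm.stronglyMeasurableAtFilter) (hr r)⟩

end Cadlag

/-! ### Extending rd-continuous functions to the real line -/

section FloorExtension

variable {X : Type*} [NormedAddCommGroup X] {T : Set ℝ} {a : ℝ}

theorem RdContinuous.continuousWithinAt_floorIn (hT : IsClosed T) (ha : IsLeast T a) {f : ℝ → X}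
    (hf : RdContinuous T f) (r : ℝ) :
    ContinuousWithinAt (fun τ => f (floorIn T a τ)) (Ici r) r := by
  by_cases hd : ∀ r', r < r' → ∃ s ∈ T, r < s ∧ s < r'
  · have hrd := rightDense_of_forall hT hd
    have hc := hf.1 r hrd
    have h1 := tendsto_floorIn_nhdsGE hT ha hrd.1
    unfold ContinuousWithinAt at hc ⊢
    simp only [floorIn_of_mem hT ha hrd.1]
    exact hc.comp h1
  · push Not at hd
    obtain ⟨r', hr', hgap⟩ := hd
    refine (continuousWithinAt_const (b := f (floorIn T a r))).congr_of_eventuallyEq ?_ rfl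
    filter_upwards [Ico_mem_nhdsGE hr'] with s hs
    rw [floorIn_eq_of_gap hs.1 fun s' hs' h => hs.2.trans_le (hgap s' hs' h)]

theorem RdContinuous.exists_tendsto_floorIn (hT : IsClosed T) (ha : IsLeast T a) {f : ℝ → X}
    (hf : RdContinuous T f) (r : ℝ) :
    ∃ l, Tendsto (fun τ => f (floorIn T a τ)) (𝓝[<] r) (𝓝 l) := by
  by_cases hd : ∀ r', r' < r → ∃ s ∈ T, r' < s ∧ s < r
  · obtain ⟨l, hl⟩ := hf.2 r (leftDense_of_forall hT hd)
    refine ⟨l, hl.comp (tendsto_nhdsWithin_iff.2 ⟨?_, ?_⟩)⟩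
    · rw [tendsto_order]
      constructor
      · intro r' hr'
        obtain ⟨s, hs, h1, h2⟩ := hd r' hr'
        filter_upwards [Ico_mem_nhdsLT h2] with τ hτ
        exact h1.trans_le (le_floorIn hT ha hs hτ.1)
      · intro r' hr'
        obtain ⟨s, hs, h1, h2⟩ := hd (r - 1) (by linarith)
        filter_upwards [Ico_mem_nhdsLT h2] with τ hτ
        exact (floorIn_le hT ha ((ha.2 hs).trans hτ.1)).trans_lt (hτ.2.trans hr')
    · obtain ⟨s, hs, h1, h2⟩ := hd (r - 1) (by linarith)
      filter_upwards [Ico_mem_nhdsLT h2] with τ hτ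
      exact ⟨floorIn_mem hT ha τ, (floorIn_le hT ha ((ha.2 hs).trans hτ.1)).trans_lt hτ.2⟩
  · push Not at hd
    obtain ⟨r', hr', hgap⟩ := hd
    refine ⟨f (floorIn T a ((r' + r) / 2)), tendsto_const_nhds.congr' ?_⟩
    filter_upwards [Ioo_mem_nhdsLT (show (r' + r) / 2 < r by linarith)] with τ hτ
    rw [floorIn_eq_of_gap hτ.1.le]
    intro s hs h
    exact hτ.2.trans_le (hgap s hs (by linarith))

theorem RdContinuous.locallyIntegrable_floorIn (hT : IsClosed T) (ha : IsLeast T a) {f : ℝ → X}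
    (hf : RdContinuous T f) : LocallyIntegrable fun τ => f (floorIn T a τ) :=
  locallyIntegrable_of_cadlag (hf.continuousWithinAt_floorIn hT ha)
    (hf.exists_tendsto_floorIn hT ha)

theorem RdContinuous.intervalIntegrable_floorIn (hT : IsClosed T) (ha : IsLeast T a) {f : ℝ → X}
    (hf : RdContinuous T f) (r s : ℝ) :
    IntervalIntegrable (fun τ => f (floorIn T a τ)) volume r s :=
  ((hf.locallyIntegrable_floorIn hT ha).integrableOn_isCompact isCompact_uIcc).intervalIntegrable

end FloorExtension

/-! ### Delta integrals as interval integrals -/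

section Integral

variable {X : Type*} [NormedAddCommGroup X] [NormedSpace ℝ X] {T : Set ℝ} {a : ℝ}

theorem isAntiderivative_integral_floorIn [CompleteSpace X] (hT : IsClosed T) (ha : IsLeast T a)
    {f : ℝ → X} (hf : RdContinuous T f) :
    IsAntiderivative T (fun t => ∫ τ in a..t, f (floorIn T a τ)) f := by
  have hi := hf.intervalIntegrable_floorIn hT ha
  have hc : Continuous fun t => ∫ τ in a..t, f (floorIn T a τ) :=
    intervalIntegral.continuous_primitive hi a
  refine ⟨hc.continuousOn, fun t ht hmax => ?_⟩
  rcases (le_sigma T t).eq_or_lt with hσ | hσ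
  · intro ε hε
    obtain ⟨δ, hδ, hfδ⟩ := Metric.continuousWithinAt_iff.1 (hf.1 t ⟨ht, hmax, hσ.symm⟩) ε hε
    have hball : Metric.ball t δ ∈ 𝓝[T] t := mem_nhdsWithin_of_mem_nhds (Metric.ball_mem_nhds t hδ)
    filter_upwards [hball, self_mem_nhdsWithin] with s hs hsT
    -- The error is the integral of `f (floorIn T a τ) - f t` between `t` and `s`; the floor of `τ`
    -- also lies between them, so continuity of `f` at `t` applies.
    rw [← hσ, intervalIntegral.integral_interval_sub_left (hi _ _) (hi _ _),
      ← intervalIntegral.integral_const, ← intervalIntegral.integral_sub (hi _ _) (by simp)]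
    refine intervalIntegral.norm_integral_le_of_norm_le_const fun τ hτ => ?_
    rw [← dist_eq_norm]
    refine (hfδ (floorIn_mem hT ha τ) ?_).le
    rw [Metric.mem_ball, Real.dist_eq, abs_lt] at hs
    rw [Real.dist_eq, abs_lt]
    rcases le_total s t with hst | hst
    · rw [uIoc_of_le hst] at hτ
      have h1 := le_floorIn hT ha hsT hτ.1.le
      have h2 := floorIn_le hT ha ((ha.2 hsT).trans hτ.1.le)
      constructor <;> linarith [hτ.2]
    · rw [uIoc_of_ge hst] at hτ
      have h1 := le_floorIn hT ha ht hτ.1.le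
      have h2 := floorIn_le hT ha ((ha.2 ht).trans hτ.1.le)
      constructor <;> linarith [hτ.2]
  · refine hasDeltaDerivAt_of_lt_sigma hσ hc.continuousWithinAt ?_
    have hconst : ∫ τ in t..sigma T t, f (floorIn T a τ) = graininess T t • f t := by
      rw [intervalIntegral.integral_of_le hσ.le, integral_Ioc_eq_integral_Ioo,
        setIntegral_congr_fun (g := fun _ => f t) measurableSet_Ioo]
      · simp [graininess, hσ.le]
      · intro τ hτ
        dsimp only
        rw [floorIn_eq_of_gap hτ.1.le fun s hs h => hτ.2.trans_le (sigma_le hs h),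
          floorIn_of_mem hT ha ht]
    rw [← hconst, intervalIntegral.integral_add_adjacent_intervals (hi _ _) (hi _ _)]

/-- The extension of `H` by `floorIn` is continuous with zero right derivative, so the real-line
constancy theorem applies. This gives uniqueness of antiderivatives up to a constant. -/
theorem eq_of_hasDeltaDerivAt_zero (hT : IsClosed T) (ha : IsLeast T a) {H : ℝ → X}
    (hc : ContinuousOn H T) (hH : ∀ t ∈ T, (∃ s ∈ T, t < s) → HasDeltaDerivAt T H 0 t)
    {t : ℝ} (ht : t ∈ T) : H t = H a := by
  have hright : ∀ r, a ≤ r → HasDerivWithinAt (fun τ => H (floorIn T a τ)) 0 (Ici r) r := by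
    intro r har
    by_cases hd : ∀ r', r < r' → ∃ s ∈ T, r < s ∧ s < r'
    · have hrd := rightDense_of_forall hT hd
      rw [hasDerivWithinAt_iff_isLittleO, Asymptotics.isLittleO_iff]
      intro ε hε
      have h1 := tendsto_floorIn_nhdsGE hT ha hrd.1
      filter_upwards [h1.eventually (hH r hrd.1 hrd.2.1 ε hε), self_mem_nhdsWithin] with s hs hrs
      rw [hrd.2.2, smul_zero, sub_zero] at hs
      rw [smul_zero, sub_zero, floorIn_of_mem hT ha hrd.1, ← norm_neg, neg_sub]
      refine hs.trans (mul_le_mul_of_nonneg_left ?_ hε.le)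
      have h2 := le_floorIn hT ha hrd.1 hrs
      have h3 := floorIn_le hT ha (har.trans hrs)
      rw [abs_sub_comm, abs_of_nonneg (by linarith), Real.norm_eq_abs, abs_of_nonneg (by linarith)]
      linarith
    · push Not at hd
      obtain ⟨r', hr', hgap⟩ := hd
      refine (hasDerivWithinAt_const r (Ici r) (H (floorIn T a r))).congr_of_eventuallyEq ?_ rfl
      filter_upwards [Ico_mem_nhdsGE hr'] with s hs
      rw [floorIn_eq_of_gap hs.1 fun s' hs' h => hs.2.trans_le (hgap s' hs' h)]
  have hleft : ∀ r, a < r → ContinuousWithinAt (fun τ => H (floorIn T a τ)) (Iio r) r := by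
    intro r har
    by_cases hd : ∀ r', r' < r → ∃ s ∈ T, r' < s ∧ s < r
    · have hrT := (leftDense_of_forall hT hd).1
      have h1 : Tendsto (floorIn T a) (𝓝[<] r) (𝓝[T] r) := by
        refine tendsto_nhdsWithin_iff.2 ⟨?_, Eventually.of_forall fun s => floorIn_mem hT ha s⟩
        rw [tendsto_order]
        constructor
        · intro r' hr'
          obtain ⟨s, hs, h1, h2⟩ := hd r' hr'
          filter_upwards [Ico_mem_nhdsLT h2] with τ hτ
          exact h1.trans_le (le_floorIn hT ha hs hτ.1)
        · intro r' hr'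
          filter_upwards [Ico_mem_nhdsLT har] with τ hτ
          exact (floorIn_le hT ha hτ.1).trans_lt (hτ.2.trans hr')
      have h2 := hc r hrT
      unfold ContinuousWithinAt at h2 ⊢
      simp only [floorIn_of_mem hT ha hrT]
      exact h2.comp h1
    · push Not at hd
      obtain ⟨r', hr', hgap⟩ := hd
      obtain ⟨m, hm1, hm2⟩ := exists_between (max_lt hr' har)
      have hm3 := (le_max_left r' a).trans_lt hm1
      have hm4 := (le_max_right r' a).trans_lt hm1
      have hev : ∀ᶠ τ in 𝓝[<] r, H (floorIn T a τ) = H (floorIn T a m) := by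
        filter_upwards [Ioo_mem_nhdsLT hm2] with τ hτ
        rw [floorIn_eq_of_gap hτ.1.le fun s hs h => hτ.2.trans_le (hgap s hs (hm3.trans h))]
      refine (continuousWithinAt_const (b := H (floorIn T a m))).congr_of_eventuallyEq hev ?_
      -- If `r` ends a gap, the floor jumps there from its predecessor `p` to `r = σ(p)`, but a zero
      -- delta derivative at `p` forces `H (σ p) = H p`.
      by_cases hrT : r ∈ T
      · have hp := floorIn_mem hT ha m
        have hpm := floorIn_le hT ha hm4.le
        have hσ : sigma T (floorIn T a m) = r := by
          refine le_antisymm (sigma_le hrT (hpm.trans_lt hm2)) ?_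
          unfold sigma
          rw [if_pos ⟨r, hrT, hpm.trans_lt hm2⟩]
          refine le_csInf ⟨r, hrT, hpm.trans_lt hm2⟩ fun s hs => ?_
          have hms : m < s := by
            by_contra! hcon
            exact absurd (le_floorIn hT ha hs.1 hcon) (not_le.2 hs.2)
          exact hgap s hs.1 (hm3.trans hms)
        have h3 := (hH _ hp ⟨r, hrT, hpm.trans_lt hm2⟩).sub_sigma hp
        rw [hσ, smul_zero, add_zero] at h3
        rw [floorIn_of_mem hT ha hrT, h3]
      · rw [floorIn_eq_of_gap hm2.le fun s hs h =>
          lt_of_le_of_ne (hgap s hs (hm3.trans h)) (fun e => hrT (e ▸ hs))]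
  have hcont : ContinuousOn (fun τ => H (floorIn T a τ)) (Icc a t) := by
    intro r hr
    rcases hr.1.eq_or_lt with h | h
    · subst h
      exact (hright a le_rfl).continuousWithinAt.mono Icc_subset_Ici_self
    · have h1 := (hleft r h).union (hright r hr.1).continuousWithinAt
      rw [Iio_union_Ici] at h1
      exact h1.mono (subset_univ _)
  have h := constant_of_has_deriv_right_zero hcont (fun r hr => hright r hr.1) t ⟨ha.2 ht, le_rfl⟩
  simpa only [floorIn_of_mem hT ha ht, floorIn_of_mem hT ha ha.1] using h

theorem IsAntiderivative.sub_eq_sub (hT : IsClosed T) (ha : IsLeast T a) {F G f : ℝ → X}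
    (hF : IsAntiderivative T F f) (hG : IsAntiderivative T G f) {r s : ℝ} (hr : r ∈ T)
    (hs : s ∈ T) : F s - F r = G s - G r := by
  have key : ∀ t ∈ T, F t - G t = F a - G a := fun t ht =>
    eq_of_hasDeltaDerivAt_zero (H := fun t => F t - G t) hT ha (hF.1.sub hG.1)
      (fun t ht hmax => by simpa using (hF.2 t ht hmax).sub (hG.2 t ht hmax)) ht
  have h1 := key r hr
  have h2 := key s hs
  rw [sub_eq_sub_iff_sub_eq_sub, h1, h2]

theorem IsAntiderivative.deltaIntegral_eq (hT : IsClosed T) (ha : IsLeast T a) {F f : ℝ → X}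
    (hF : IsAntiderivative T F f) {r s : ℝ} (hr : r ∈ T) (hs : s ∈ T) :
    deltaIntegral T f r s = F s - F r := by
  have hex : ∃ F : ℝ → X, IsAntiderivative T F f := ⟨F, hF⟩
  unfold deltaIntegral
  rw [dif_pos hex]
  exact hex.choose_spec.sub_eq_sub hT ha hF hr hs

theorem deltaIntegral_eq_integral_floorIn [CompleteSpace X] (hT : IsClosed T) (ha : IsLeast T a)
    {f : ℝ → X} (hf : RdContinuous T f) {r s : ℝ} (hr : r ∈ T) (hs : s ∈ T) :
    deltaIntegral T f r s = ∫ τ in r..s, f (floorIn T a τ) := by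
  rw [(isAntiderivative_integral_floorIn hT ha hf).deltaIntegral_eq hT ha hr hs,
    intervalIntegral.integral_interval_sub_left] <;>
  exact hf.intervalIntegrable_floorIn hT ha _ _

end Integral

/-! ### Stability of rd-continuity -/

section RdContinuous

variable {X Y : Type*} [NormedAddCommGroup X] [NormedAddCommGroup Y] {T : Set ℝ}

theorem rdContinuous_of_continuousOn {f : ℝ → X} (hf : ContinuousOn f T) : RdContinuous T f :=
  ⟨fun t ht => hf t ht.1, fun t ht => ⟨f t, (hf t ht.1).mono inter_subset_left⟩⟩

theorem RdContinuous.continuous_comp {f : ℝ → X} (hf : RdContinuous T f) {φ : X → Y}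
    (hφ : Continuous φ) : RdContinuous T fun t => φ (f t) :=
  ⟨fun t ht => hφ.continuousAt.comp_continuousWithinAt (hf.1 t ht), fun t ht =>
    let ⟨l, hl⟩ := hf.2 t ht
    ⟨φ l, (hφ.tendsto l).comp hl⟩⟩

theorem RdContinuous.prodMk {f : ℝ → X} {g : ℝ → Y} (hf : RdContinuous T f)
    (hg : RdContinuous T g) : RdContinuous T fun t => (f t, g t) :=
  ⟨fun t ht => (hf.1 t ht).prodMk (hg.1 t ht), fun t ht =>
    let ⟨l, hl⟩ := hf.2 t ht
    let ⟨m, hm⟩ := hg.2 t ht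
    ⟨(l, m), hl.prodMk_nhds hm⟩⟩

theorem RdContinuous.sub {f g : ℝ → X} (hf : RdContinuous T f) (hg : RdContinuous T g) :
    RdContinuous T fun t => f t - g t :=
  (hf.prodMk hg).continuous_comp (continuous_fst.sub continuous_snd)

theorem RdContinuous.mul {f g : ℝ → ℝ} (hf : RdContinuous T f) (hg : RdContinuous T g) :
    RdContinuous T fun t => f t * g t :=
  (hf.prodMk hg).continuous_comp (continuous_fst.mul continuous_snd)

theorem RdContinuous.const_mul {f : ℝ → ℝ} (hf : RdContinuous T f) (c : ℝ) :
    RdContinuous T fun t => c * f t :=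
  hf.continuous_comp (continuous_const.mul continuous_id)

/-- Freezing the inner argument at its limit `v` costs at most `L s * ‖x s - v‖`, which tends to
zero because `L` has a finite limit. -/
theorem tendsto_comp_of_lipschitz {k : ℝ → X → Y} {L : ℝ → ℝ} {x : ℝ → X} {t : ℝ} {l : Filter ℝ}
    (hl : l ≤ 𝓝[T] t) (hL : ContinuousWithinAt L T t)
    (hlip : ∀ s ∈ T, ∀ v v', ‖k s v - k s v'‖ ≤ L s * ‖v - v'‖) {v : X} {m : Y}
    (hx : Tendsto x l (𝓝 v)) (hk : Tendsto (fun s => k s v) l (𝓝 m)) :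
    Tendsto (fun s => k s (x s)) l (𝓝 m) := by
  have h1 : Tendsto (fun s => L s * ‖x s - v‖) l (𝓝 0) := by
    have h2 := (hx.sub_const v).norm
    rw [sub_self, norm_zero] at h2
    simpa using (hL.tendsto.mono_left hl).mul h2
  have h3 : Tendsto (fun s => k s (x s) - k s v) l (𝓝 0) := by
    refine squeeze_zero_norm' ?_ h1
    filter_upwards [hl self_mem_nhdsWithin] with s hs using hlip s hs _ _
  simpa using h3.add hk

theorem RdContinuous.comp_of_lipschitz {k : ℝ → X → Y} {L : ℝ → ℝ} {x : ℝ → X}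
    (hk : ∀ v, RdContinuous T fun s => k s v) (hL : ContinuousOn L T)
    (hlip : ∀ s ∈ T, ∀ v v', ‖k s v - k s v'‖ ≤ L s * ‖v - v'‖) (hx : RdContinuous T x) :
    RdContinuous T fun s => k s (x s) :=
  ⟨fun t ht => tendsto_comp_of_lipschitz le_rfl (hL t ht.1) hlip (hx.1 t ht) ((hk _).1 t ht),
    fun t ht =>
      let ⟨v, hv⟩ := hx.2 t ht
      let ⟨m, hm⟩ := (hk v).2 t ht
      ⟨m, tendsto_comp_of_lipschitz (nhdsWithin_mono t inter_subset_left) (hL t ht.1) hlip hv hm⟩⟩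

end RdContinuous

/-! ### The cylinder transformation -/

section Cylinder

variable {T : Set ℝ}

/-- As a function of `h`, this is the slope of `log (1 + h c)` at `0`, completed by the derivative
`c`. -/
theorem continuousAt_cylinder_zero (c : ℝ) : ContinuousAt (fun h => cylinder h c) 0 := by
  have h1 : HasDerivAt (fun h : ℝ => Real.log (1 + h * c)) c 0 := by
    have h2 : HasDerivAt (fun h : ℝ => 1 + h * c) c 0 := by
      simpa using ((hasDerivAt_id (0 : ℝ)).mul_const c).const_add 1
    simpa using h2.log (by simp)
  have h3 := continuousAt_update_same.2 h1.tendsto_slope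
  convert h3 using 1
  ext h
  by_cases hh : h = 0
  · simp [hh, cylinder]
  · simp [hh, cylinder, slope_def_field]

theorem graininess_le {t s : ℝ} (hs : s ∈ T) (hts : t < s) : graininess T t ≤ s - t :=
  sub_le_sub_right (sigma_le hs hts) t

theorem RightDense.tendsto_graininess {t : ℝ} (ht : RightDense T t) :
    Tendsto (graininess T) (𝓝[T] t) (𝓝 0) := by
  rw [Metric.tendsto_nhds]
  intro ε hε
  obtain ⟨s', hs', h1, h2⟩ := exists_mem_Ioo_of_sigma_eq ht.2.1 ht.2.2 (lt_add_of_pos_right t hε)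
  filter_upwards [mem_nhdsWithin_of_mem_nhds (Ioo_mem_nhds (sub_lt_self t hε) h1)] with s hs
  rw [Real.dist_eq, sub_zero, abs_of_nonneg (graininess_nonneg T s)]
  rcases lt_or_ge s t with h | h
  · linarith [graininess_le ht.1 h, hs.1]
  · linarith [graininess_le hs' hs.2]

theorem LeftDense.tendsto_graininess {t : ℝ} (ht : LeftDense T t) :
    Tendsto (graininess T) (𝓝[T ∩ Iio t] t) (𝓝 0) := by
  have h1 : Tendsto (fun s => t - s) (𝓝[T ∩ Iio t] t) (𝓝 0) := by
    have h2 : Continuous fun s : ℝ => t - s := by fun_prop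
    simpa using (h2.tendsto t).mono_left (nhdsWithin_le_nhds (s := T ∩ Iio t))
  refine squeeze_zero' (Eventually.of_forall (graininess_nonneg T)) ?_ h1
  filter_upwards [self_mem_nhdsWithin] with s hs using graininess_le ht.1 hs.2

theorem rdContinuous_cylinder (T : Set ℝ) (c : ℝ) :
    RdContinuous T fun t => cylinder (graininess T t) c := by
  refine ⟨fun t ht => ?_, fun t ht =>
    ⟨_, (continuousAt_cylinder_zero c).tendsto.comp ht.tendsto_graininess⟩⟩
  have h0 : graininess T t = 0 := sub_eq_zero.2 ht.2.2
  unfold ContinuousWithinAt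
  beta_reduce
  rw [h0]
  exact (continuousAt_cylinder_zero c).tendsto.comp ht.tendsto_graininess

theorem cylinder_circleMinus {β α : ℝ} (hβ : 0 ≤ β) (hα : 0 ≤ α) (t : ℝ) :
    cylinder (graininess T t) (circleMinus T (fun _ => β) (fun _ => α) t) =
      cylinder (graininess T t) β - cylinder (graininess T t) α := by
  have hμ := graininess_nonneg T t
  unfold circleMinus circlePlus circleNeg cylinder
  generalize graininess T t = μ at hμ ⊢
  split_ifs with h
  · simp [h]; ring
  · have h1 : 0 < 1 + μ * β := by positivity
    have h2 : 0 < 1 + μ * α := by positivity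
    rw [← sub_div, ← Real.log_div h1.ne' h2.ne']
    congr 2
    field_simp
    ring

end Cylinder

/-! ### Linearity and monotonicity of the delta integral -/

section DeltaIntegral

variable {X : Type*} [NormedAddCommGroup X] [NormedSpace ℝ X] {T : Set ℝ} {a : ℝ}

theorem deltaIntegral_sub_left (T : Set ℝ) (f : ℝ → X) (a r s : ℝ) :
    deltaIntegral T f a s - deltaIntegral T f a r = deltaIntegral T f r s := by
  unfold deltaIntegral
  split_ifs <;> simp

theorem deltaIntegral_self (T : Set ℝ) (f : ℝ → X) (a : ℝ) : deltaIntegral T f a a = 0 := by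
  unfold deltaIntegral
  split_ifs <;> simp

theorem exists_isAntiderivative [CompleteSpace X] (hT : IsClosed T) (ha : IsLeast T a) {f : ℝ → X}
    (hf : RdContinuous T f) : ∃ F : ℝ → X, IsAntiderivative T F f ∧
      ∀ r s, deltaIntegral T f r s = F s - F r := by
  have hex : ∃ F : ℝ → X, IsAntiderivative T F f := ⟨_, isAntiderivative_integral_floorIn hT ha hf⟩
  refine ⟨hex.choose, hex.choose_spec, fun r s => ?_⟩
  unfold deltaIntegral
  rw [dif_pos hex]

theorem deltaIntegral_sub [CompleteSpace X] (hT : IsClosed T) (ha : IsLeast T a) {f g : ℝ → X}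
    (hf : RdContinuous T f) (hg : RdContinuous T g) {r s : ℝ} (hr : r ∈ T) (hs : s ∈ T) :
    deltaIntegral T (fun t => f t - g t) r s = deltaIntegral T f r s - deltaIntegral T g r s := by
  rw [deltaIntegral_eq_integral_floorIn hT ha hf hr hs,
    deltaIntegral_eq_integral_floorIn hT ha hg hr hs,
    deltaIntegral_eq_integral_floorIn hT ha (hf.sub hg) hr hs,
    intervalIntegral.integral_sub (hf.intervalIntegrable_floorIn hT ha r s)
      (hg.intervalIntegrable_floorIn hT ha r s)]

theorem deltaIntegral_const_mul (hT : IsClosed T) (ha : IsLeast T a) {f : ℝ → ℝ}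
    (hf : RdContinuous T f) (c : ℝ) {r s : ℝ} (hr : r ∈ T) (hs : s ∈ T) :
    deltaIntegral T (fun t => c * f t) r s = c * deltaIntegral T f r s := by
  rw [deltaIntegral_eq_integral_floorIn hT ha hf hr hs,
    deltaIntegral_eq_integral_floorIn hT ha (hf.const_mul c) hr hs,
    intervalIntegral.integral_const_mul]

theorem norm_deltaIntegral_le [CompleteSpace X] (hT : IsClosed T) (ha : IsLeast T a) {f : ℝ → X}
    {φ : ℝ → ℝ} (hf : RdContinuous T f) (hφ : RdContinuous T φ) (h : ∀ t ∈ T, ‖f t‖ ≤ φ t)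
    {r s : ℝ} (hr : r ∈ T) (hs : s ∈ T) (hrs : r ≤ s) :
    ‖deltaIntegral T f r s‖ ≤ deltaIntegral T φ r s := by
  rw [deltaIntegral_eq_integral_floorIn hT ha hf hr hs,
    deltaIntegral_eq_integral_floorIn hT ha hφ hr hs]
  exact intervalIntegral.norm_integral_le_of_norm_le hrs
    (Eventually.of_forall fun t _ => h _ (floorIn_mem hT ha t))
    (hφ.intervalIntegrable_floorIn hT ha r s)

theorem deltaIntegral_mono (hT : IsClosed T) (ha : IsLeast T a) {φ ψ : ℝ → ℝ}
    (hφ : RdContinuous T φ) (hψ : RdContinuous T ψ) (h : ∀ t ∈ T, φ t ≤ ψ t)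
    {r s : ℝ} (hr : r ∈ T) (hs : s ∈ T) (hrs : r ≤ s) :
    deltaIntegral T φ r s ≤ deltaIntegral T ψ r s := by
  rw [deltaIntegral_eq_integral_floorIn hT ha hφ hr hs,
    deltaIntegral_eq_integral_floorIn hT ha hψ hr hs]
  exact intervalIntegral.integral_mono_on hrs (hφ.intervalIntegrable_floorIn hT ha r s)
    (hψ.intervalIntegrable_floorIn hT ha r s) fun t _ => h _ (floorIn_mem hT ha t)

end DeltaIntegral

/-! ### The exponential function -/

section Exponential

variable {T : Set ℝ} {a : ℝ}

theorem expT_pos (T : Set ℝ) (p : ℝ → ℝ) (t s : ℝ) : 0 < expT T p t s := Real.exp_pos _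

theorem expT_self (T : Set ℝ) (p : ℝ → ℝ) (t : ℝ) : expT T p t t = 1 := by
  simp [expT, deltaIntegral_self]

theorem expT_eq_div (T : Set ℝ) (p : ℝ → ℝ) (a t s : ℝ) :
    expT T p t s = expT T p t a / expT T p s a := by
  simp only [expT]
  rw [← Real.exp_sub, deltaIntegral_sub_left]

theorem expT_circleMinus (hT : IsClosed T) (ha : IsLeast T a) {β α : ℝ} (hβ : 0 ≤ β) (hα : 0 ≤ α)
    {t s : ℝ} (ht : t ∈ T) (hs : s ∈ T) :
    expT T (circleMinus T (fun _ => β) (fun _ => α)) t s =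
      expT T (fun _ => β) t s / expT T (fun _ => α) t s := by
  simp only [expT, cylinder_circleMinus hβ hα]
  rw [← Real.exp_sub, deltaIntegral_sub hT ha (rdContinuous_cylinder T β)
    (rdContinuous_cylinder T α) hs ht]

theorem graininess_mul_cylinder {c : ℝ} (hc : 0 ≤ c) (t : ℝ) :
    Real.exp (graininess T t * cylinder (graininess T t) c) = 1 + graininess T t * c := by
  have hμ := graininess_nonneg T t
  unfold cylinder
  split_ifs with h
  · simp [h]
  · rw [mul_div_cancel₀ _ h, Real.exp_log (by positivity)]

/-- At right-dense points this is the chain rule; across a gap the exponential is multiplied by `exp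
(μ ξ_μ(c)) = 1 + μ c`. -/
theorem isAntiderivative_expT (hT : IsClosed T) (ha : IsLeast T a) {c : ℝ} (hc : 0 ≤ c) (r : ℝ) :
    IsAntiderivative T (fun t => expT T (fun _ => c) t r)
      (fun t => c * expT T (fun _ => c) t r) := by
  obtain ⟨F, hF, hFe⟩ := exists_isAntiderivative hT ha (rdContinuous_cylinder T c)
  simp only [expT, hFe]
  have hcont : ContinuousOn (fun t => Real.exp (F t - F r)) T :=
    (hF.1.sub continuousOn_const).rexp
  refine ⟨hcont, fun t ht hmax => ?_⟩
  have hd := hF.2 t ht hmax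
  rcases (le_sigma T t).eq_or_lt with hσ | hσ
  · rw [hasDeltaDerivAt_iff_of_sigma_eq hσ.symm] at hd ⊢
    have hμ : graininess T t = 0 := sub_eq_zero.2 hσ.symm
    simp only [hμ, cylinder, if_true] at hd
    dsimp only
    rw [mul_comm]
    exact (hd.sub_const (F r)).exp
  · refine hasDeltaDerivAt_of_lt_sigma hσ (hcont t ht) ?_
    dsimp only
    rw [hd.sub_sigma ht, add_sub_right_comm, Real.exp_add, smul_eq_mul, smul_eq_mul,
      graininess_mul_cylinder hc]
    ring

end Exponential

/-! ### Gronwall's inequality -/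

section Gronwall

variable {T : Set ℝ} {a : ℝ}

/-- The primitive `Y` of the extended positive part of `w` satisfies `Y' ≤ c Y` and `Y a = 0`, so
classical Gronwall makes it vanish. -/
theorem nonpos_of_le_deltaIntegral (hT : IsClosed T) (ha : IsLeast T a) {c : ℝ} (hc : 0 ≤ c)
    {w : ℝ → ℝ} (hw : RdContinuous T w) (h : ∀ t ∈ T, w t ≤ c * deltaIntegral T w a t)
    {t : ℝ} (ht : t ∈ T) : w t ≤ 0 := by
  have hψ : RdContinuous T fun t => max (w t) 0 :=
    hw.continuous_comp (continuous_id.max continuous_const)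
  have hi := hψ.intervalIntegrable_floorIn hT ha
  set ψ : ℝ → ℝ := fun τ => max (w (floorIn T a τ)) 0 with hψdef
  have hψ0 : ∀ τ, 0 ≤ ψ τ := fun τ => le_max_right _ _
  have hY0 : ∀ τ, a ≤ τ → 0 ≤ ∫ r in a..τ, ψ r := fun τ hτ =>
    intervalIntegral.integral_nonneg hτ fun r _ => hψ0 r
  have hle : ∀ τ, a ≤ τ → ψ τ ≤ c * ∫ r in a..τ, ψ r := by
    intro τ hτ
    have hp := floorIn_mem hT ha τ
    refine max_le ((h _ hp).trans (mul_le_mul_of_nonneg_left ?_ hc)) (mul_nonneg hc (hY0 τ hτ))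
    rw [deltaIntegral_eq_integral_floorIn hT ha hw ha.1 hp]
    refine (intervalIntegral.integral_mono_on (ha.2 hp) (hw.intervalIntegrable_floorIn hT ha _ _)
      (hi _ _) fun r _ => le_max_left _ _).trans ?_
    -- The hypothesis reaches only the floor of `τ`; nonnegativity of `ψ` allows enlarging the
    -- interval up to `τ`. This is why the positive part is taken.
    exact intervalIntegral.integral_mono_interval le_rfl (ha.2 hp) (floorIn_le hT ha hτ)
      (Eventually.of_forall hψ0) (hi _ _)
  have hm := (stronglyMeasurable_of_continuousWithinAt_Ici
    (hψ.continuousWithinAt_floorIn hT ha)).aestronglyMeasurable (μ := volume)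
  have hG := norm_le_gronwallBound_of_norm_deriv_right_le (f := fun τ => ∫ r in a..τ, ψ r)
    (f' := ψ) (δ := 0) (K := c) (ε := 0) (a := a) (b := t)
    (intervalIntegral.continuous_primitive hi a).continuousOn
    (fun r _ => intervalIntegral.integral_hasDerivWithinAt_right (hi a r)
      (s := Ici r) (t := Ioi r) hm.stronglyMeasurableAtFilter
      ((hψ.continuousWithinAt_floorIn hT ha r).mono Ioi_subset_Ici_self))
    (by simp)
    (fun r hr => by
      rw [Real.norm_of_nonneg (hψ0 r), Real.norm_of_nonneg (hY0 r hr.1), add_zero]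
      exact hle r hr.1) t ⟨ha.2 ht, le_rfl⟩
  rw [gronwallBound_ε0_δ0, norm_le_zero_iff] at hG
  have h1 := hle t (ha.2 ht)
  rw [hG, mul_zero] at h1
  have h2 := (le_max_left _ _).trans h1
  rwa [floorIn_of_mem hT ha ht] at h2

/-- Gronwall's inequality on a time scale with least element `a`. -/
theorem le_mul_expT_of_le_deltaIntegral (hT : IsClosed T) (ha : IsLeast T a) {c K : ℝ}
    (hc : 0 ≤ c) {u : ℝ → ℝ} (hu : RdContinuous T u)
    (h : ∀ t ∈ T, u t ≤ K + c * deltaIntegral T u a t) {t : ℝ} (ht : t ∈ T) :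
    u t ≤ K * expT T (fun _ => c) t a := by
  have hE := isAntiderivative_expT hT ha hc a
  have hErd : RdContinuous T fun t => expT T (fun _ => c) t a := rdContinuous_of_continuousOn hE.1
  -- `K e_c(·,a)` attains equality in the integral inequality, so subtracting it removes the
  -- constant.
  have hw := nonpos_of_le_deltaIntegral hT ha hc (hu.sub (hErd.const_mul K)) (fun s hs => ?_) ht
  · exact sub_nonpos.1 hw
  · have h1 := hE.deltaIntegral_eq hT ha ha.1 hs
    rw [deltaIntegral_const_mul hT ha hErd c ha.1 hs, expT_self] at h1
    rw [deltaIntegral_sub hT ha hu (hErd.const_mul K) ha.1 hs,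
      deltaIntegral_const_mul hT ha hErd K ha.1 hs, mul_sub, mul_left_comm, h1]
    linarith [h s hs]

end Gronwall

/-! ### Estimating the integral terms -/

section Kernel

variable {X : Type*} [NormedAddCommGroup X] [NormedSpace ℝ X] [CompleteSpace X] {T : Set ℝ} {a : ℝ}

/-- One estimate serves both integrals: `r = t` for the Volterra term and `r = b` for the Fredholm
term. -/
theorem norm_deltaIntegral_kernel_sub_le (hT : IsClosed T) (ha : IsLeast T a) {α c t : ℝ}
    (hα : 0 ≤ α) {k : ℝ → X → X} (hk : ∀ v, RdContinuous T fun s => k s v)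
    (hlip : ∀ s ∈ T, ∀ v v', ‖k s v - k s v'‖ ≤ c * expT T (fun _ => α) s t * ‖v - v'‖)
    {x : ℝ → X} (hx : RdContinuous T x) {r : ℝ} (hr : r ∈ T) :
    ‖deltaIntegral T (fun s => k s (x s)) a r - deltaIntegral T (fun s => k s 0) a r‖ ≤
      c / expT T (fun _ => α) t a *
        deltaIntegral T (fun s => expT T (fun _ => α) s a * ‖x s‖) a r := by
  have hE := fun t => (isAntiderivative_expT hT ha hα t).1
  have hkx : RdContinuous T fun s => k s (x s) :=
    RdContinuous.comp_of_lipschitz hk (continuousOn_const.mul (hE t)) hlip hx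
  have hu : RdContinuous T fun s => expT T (fun _ => α) s a * ‖x s‖ :=
    (rdContinuous_of_continuousOn (hE a)).mul (hx.continuous_comp continuous_norm)
  rw [← deltaIntegral_sub hT ha hkx (hk 0) ha.1 hr, ← deltaIntegral_const_mul hT ha hu _ ha.1 hr]
  refine norm_deltaIntegral_le hT ha (hkx.sub (hk 0)) (hu.const_mul _) (fun s hs => ?_) ha.1 hr
    (ha.2 hr)
  refine (hlip s hs _ _).trans_eq ?_
  rw [sub_zero, expT_eq_div T _ a s t]
  ring

end Kernel

end TimeScale

/-! ### The bound for solutions -/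

theorem theorem5p1 {X : Type*} [NormedAddCommGroup X] [NormedSpace ℝ X] [CompleteSpace X]
    (T : Set ℝ) (hT : TimeScale.IsTimeScale T)
    (a b : ℝ) (ha : a ∈ T) (hb : b ∈ T) (hab : a < b)
    (I : Set ℝ) (hI : I = TimeScale.ray T a)
    (f : ℝ → X → X → X → X) (h g : ℝ → ℝ → X → X)
    (hf_rd : ∀ u v w : X, TimeScale.RdContinuous I (fun t => f t u v w))
    (hh_rd : ∀ t ∈ I, ∀ v : X, TimeScale.RdContinuous I (fun s => h t s v))
    (hg_rd : ∀ t ∈ I, ∀ v : X, TimeScale.RdContinuous I (fun s => g t s v))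
    (α B C N : ℝ) (hα : 0 < α) (hB : 0 < B) (hC : 0 < C) (hN0 : 0 ≤ N) (hN1 : N < 1)
    (hf_lip : ∀ t ∈ I, ∀ u v w u' v' w' : X,
      ‖f t u v w - f t u' v' w'‖ ≤ N * (‖u - u'‖ + ‖v - v'‖ + ‖w - w'‖))
    (hh_lip : ∀ t ∈ I, ∀ s ∈ I, ∀ v v' : X,
      ‖h t s v - h t s v'‖ ≤ B * TimeScale.expT I (fun _ => α) s t * ‖v - v'‖)
    (hg_lip : ∀ t ∈ I, ∀ s ∈ I, ∀ u u' : X,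
      ‖g t s u - g t s u'‖ ≤ C * TimeScale.expT I (fun _ => α) s t * ‖u - u'‖)
    (Nstar : ℝ) (hNstar : Nstar = N / (1 - N))
    (q : ℝ)
    (hq : q = TimeScale.deltaIntegral I
      (fun s => C * Nstar * TimeScale.expT I (fun _ => B * Nstar) s a) a b)
    (hq1 : q < 1)
    (d : ℝ) (hd : 0 ≤ d)
    (hforce : ∀ t ∈ I,
      ‖f t 0 (TimeScale.deltaIntegral I (fun s => h t s 0) a t)
          (TimeScale.deltaIntegral I (fun s => g t s 0) a b)‖
        ≤ d / TimeScale.expT I (fun _ => α) t a)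
    (x : ℝ → X) (hx : TimeScale.IsSolution I a b f h g x) :
    ∀ t ∈ I, ‖x t‖ ≤ d / ((1 - N) * (1 - q)) *
      TimeScale.expT I (TimeScale.circleMinus I (fun _ => B * Nstar) (fun _ => α)) t a := by
  open TimeScale in
  have hIc : IsClosed I := hI ▸ hT.2.inter isClosed_Ici
  have haI : IsLeast I a := hI ▸ ⟨⟨ha, self_mem_Ici⟩, fun s hs => hs.2⟩
  have hbI : b ∈ I := hI ▸ ⟨hb, hab.le⟩
  have hN : 0 < 1 - N := sub_pos.2 hN1
  have hNs : 0 ≤ Nstar := hNstar ▸ div_nonneg hN0 hN.le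
  have hβ : 0 ≤ B * Nstar := mul_nonneg hB.le hNs
  have hEα := (isAntiderivative_expT hIc haI hα.le a).1
  have hEβ : RdContinuous I fun t => expT I (fun _ => B * Nstar) t a :=
    rdContinuous_of_continuousOn (isAntiderivative_expT hIc haI hβ a).1
  set u : ℝ → ℝ := fun s => expT I (fun _ => α) s a * ‖x s‖ with hu_def
  have hu : RdContinuous I u :=
    (rdContinuous_of_continuousOn hEα).mul (hx.1.continuous_comp continuous_norm)
  set J := deltaIntegral I u a b with hJ
  set K := d / (1 - N) + Nstar * C * J with hK
  have hbound : ∀ t ∈ I, u t ≤ K + B * Nstar * deltaIntegral I u a t := by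
    intro t ht
    have hE := expT_pos I (fun _ => α) t a
    have h1 := norm_deltaIntegral_kernel_sub_le hIc haI hα.le (hh_rd t ht) (hh_lip t ht) hx.1 ht
    have h2 := norm_deltaIntegral_kernel_sub_le hIc haI hα.le (hg_rd t ht) (hg_lip t ht) hx.1 hbI
    have h3 := hf_lip t ht (x t) (deltaIntegral I (fun s => h t s (x s)) a t)
      (deltaIntegral I (fun s => g t s (x s)) a b) 0 (deltaIntegral I (fun s => h t s 0) a t)
      (deltaIntegral I (fun s => g t s 0) a b)
    rw [← hx.2 t ht, sub_zero] at h3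
    have h4 := (norm_le_norm_sub_add (x t) _).trans (add_le_add h3 (hforce t ht))
    set E := expT I (fun _ => α) t a with hE_def
    have h5 : ‖x t‖ ≤ N * (‖x t‖ + B / E * deltaIntegral I u a t + C / E * J) + d / E :=
      h4.trans (by gcongr)
    have h6 : u t ≤ N * (u t + B * deltaIntegral I u a t + C * J) + d := by
      have h7 := mul_le_mul_of_nonneg_left h5 hE.le
      refine h7.trans_eq ?_
      simp only [hu_def, ← hE_def]
      field_simp
    -- Moving `N * u t` to the left and dividing by `1 - N` is what turns `N` into `Nstar`.
    have h8 : u t * (1 - N) ≤ d + N * C * J + N * B * deltaIntegral I u a t := by linarith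
    rw [← le_div_iff₀ hN] at h8
    refine h8.trans_eq ?_
    rw [hK, hNstar]
    field_simp
  have hgr : ∀ t ∈ I, u t ≤ K * expT I (fun _ => B * Nstar) t a := fun t ht =>
    le_mul_expT_of_le_deltaIntegral hIc haI hβ hu hbound ht
  -- `K` contains the unknown `J`; integrating the Gronwall bound over `[a, b]` closes the loop,
  -- since `Nstar * C` times the integral of the exponential is `q`.
  have hKq : K ≤ d / (1 - N) + K * q := by
    have h1 := deltaIntegral_mono hIc haI hu (hEβ.const_mul K) hgr haI.1 hbI hab.le
    rw [deltaIntegral_const_mul hIc haI hEβ K haI.1 hbI] at h1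
    rw [deltaIntegral_const_mul hIc haI hEβ _ haI.1 hbI] at hq
    have h2 := mul_le_mul_of_nonneg_left h1 (mul_nonneg hNs hC.le)
    rw [hq]
    calc K = d / (1 - N) + Nstar * C * J := hK
      _ ≤ _ := add_le_add_right h2 _
      _ = _ := by ring
  have hKd : K ≤ d / ((1 - N) * (1 - q)) := by
    rw [← div_div, le_div_iff₀ (sub_pos.2 hq1)]
    linarith
  intro t ht
  rw [expT_circleMinus hIc haI hβ hα.le ht haI.1, ← mul_div_assoc,
    le_div_iff₀ (expT_pos _ _ _ _), mul_comm]
  exact (hgr t ht).trans (mul_le_mul_of_nonneg_right hKd (expT_pos _ _ _ _).le)
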